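/- Let $p,q$ be positive integers and let $(\tilde M^{n+1},\langle\cdot,\cdot\rangle,\tilde\nabla,J)$ be a locally metallic Riemannian manifold: $\tilde\nabla$ is the Levi-Civita connection, and $J$ is a $(1,1)$ tensor field with $J^2=pJ+qI$, $\langle JX,Y\rangle=\langle X,JY\rangle$ and $\tilde\nabla J=0$. Let $M^n$ be a (possibly only isometrically immersed) hypersurface of $\tilde M^{n+1}$ with induced metric $g$, Levi-Civita connection $\nabla$ of $g$, global smooth unit normal field $\nu$, shape operator $A$ defined by $\tilde\nabla_X\nu=-AX$, and second fundamental form $h(X,Y)$ defined as the $\nu$-component of $\tilde\nabla_XY$. Suppose that $M$ is a quadratic metric $\phi$-hypersurface, i.e. there are a $(1,1)$ tensor field $\phi$, a $1$-form $\eta$ and a vector field $\xi$ on $M$ such that $$JX=\phi X+\eta(X)\nu,\qquad J\nu=q\xi+p\nu,\qquad J\xi=\nu$$ for all $X\in\Gamma(TM)$, and $(g,\phi,\eta,\xi)$ is an almost quadratic metric $\phi$-structure with constants $p,q$: $\xi$ is a unit vector field, $\phi\xi=0$, $\phi^2=p\phi+q(I-\eta\otimes\xi)$ (where $q\neq0$,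 $p^2+4q\neq0$) and $g(\phi X,Y)=g(X,\phi Y)$. Let $R(X,Y)Z=\nabla_X\nabla_YZ-\nabla_Y\nabla_XZ-\nabla_{[X,Y]}Z$ be the curvature tensor of $(M,g)$. Then for all $X,Y\in\Gamma(TM)$ $$R(X,Y)\xi=p\big((\nabla_XA)Y-(\nabla_YA)X\big)-\phi\big((\nabla_XA)Y-(\nabla_YA)X\big).$$ In particular, if the second fundamental form is parallel, that is, $X(h(Y,Z))=h(\nabla_XY,Z)+h(Y,\nabla_XZ)$ for all $X,Y,Z\in\Gamma(TM)$, then $R(X,Y)\xi=0$ for all $X,Y\in\Gamma(TM)$. -/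

import Mathlib

open Bundle
open scoped Manifold ContDiff

noncomputable section

namespace MetallicHypersurface

section Connection

variable {E : Type*} [NormedAddCommGroup E] [NormedSpace ℝ E] [FiniteDimensional ℝ E]
  {H : Type*} [TopologicalSpace H] {I : ModelWithCorners ℝ E H}
  {M : Type*} [TopologicalSpace M] [ChartedSpace H M] [IsManifold I ∞ M]

/-- A `(1,1)` tensor field: a smooth family of endomorphisms of the tangent spaces. -/
def IsSmoothEndField (T : ∀ x : M, TangentSpace I x →L[ℝ] TangentSpace I x) : Prop :=
  ContMDiff I (I.prod 𝓘(ℝ, E →L[ℝ] E)) ∞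
    (fun x ↦ TotalSpace.mk' (E →L[ℝ] E)
      (E := fun x : M ↦ TangentSpace I x →L[ℝ] TangentSpace I x) x (T x))

/-- A smooth vector field. -/
def IsSmoothField (X : ∀ x : M, TangentSpace I x) : Prop :=
  ContMDiff I (I.prod 𝓘(ℝ, E)) ∞ (fun x ↦ TotalSpace.mk' E (E := TangentSpace I) x (X x))

/-- A smooth 1-form. -/
def IsSmoothOneForm (η : ∀ x : M, TangentSpace I x →L[ℝ] ℝ) : Prop :=
  ContMDiff I (I.prod 𝓘(ℝ, E →L[ℝ] ℝ)) ∞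
    (fun x ↦ TotalSpace.mk' (E →L[ℝ] ℝ) (E := fun x : M ↦ TangentSpace I x →L[ℝ] ℝ) x (η x))

/-- `∇` is the Levi-Civita connection of the Riemannian metric of `M`: a smooth, metric and
torsion-free connection on the tangent bundle. Recall that `cov Y x (X x)` is `(∇_X Y)(x)`. -/
structure IsLeviCivita [RiemannianBundle (fun x : M ↦ TangentSpace I x)]
    [IsContMDiffRiemannianBundle I ∞ E (fun x : M ↦ TangentSpace I x)]
    (cov : CovariantDerivative I E (fun x : M ↦ TangentSpace I x)) : Prop where
  smooth : CovariantDerivative.ContMDiffCovariantDerivative cov ∞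
  metric : CovariantDerivative.IsMetricCompatible (V := fun x : M ↦ TangentSpace I x) cov
  torsion_free : cov.torsion = 0

variable (cov : CovariantDerivative I E (fun x : M ↦ TangentSpace I x))

/-- The curvature `R(X,Y)Z = ∇_X ∇_Y Z - ∇_Y ∇_X Z - ∇_{[X,Y]} Z`. -/
def curvature (X Y Z : ∀ x : M, TangentSpace I x) (x : M) : TangentSpace I x :=
  cov (fun z ↦ cov Z z (Y z)) x (X x) - cov (fun z ↦ cov Z z (X z)) x (Y x)
    - cov Z x (VectorField.mlieBracket I X Y x)

/-- `(∇_X T) Y = ∇_X (T Y) - T (∇_X Y)` for a `(1,1)` tensor field `T`. -/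
def covDerivEnd (T : ∀ x : M, TangentSpace I x →L[ℝ] TangentSpace I x)
    (X Y : ∀ x : M, TangentSpace I x) (x : M) : TangentSpace I x :=
  cov (fun z ↦ T z (Y z)) x (X x) - T x (cov Y x (X x))

/-- `(g, J)` is a locally metallic Riemannian structure: `J` is a `(1,1)` tensor field with
`J² = pJ + qI`, it is `g`-symmetric, and `∇J = 0`. -/
structure IsLocallyMetallic [RiemannianBundle (fun x : M ↦ TangentSpace I x)] (p q : ℕ)
    (J : ∀ x : M, TangentSpace I x →L[ℝ] TangentSpace I x) : Prop where
  p_pos : 0 < p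
  q_pos : 0 < q
  smooth : IsSmoothEndField J
  sq : ∀ (x : M) (v : TangentSpace I x), J x (J x v) = (p : ℝ) • J x v + (q : ℝ) • v
  symm : ∀ (x : M) (v w : TangentSpace I x), inner ℝ (J x v) w = inner ℝ v (J x w)
  parallel : ∀ (X Y : ∀ x : M, TangentSpace I x) (x : M),
    MDifferentiableAt I (I.prod 𝓘(ℝ, E)) (fun z ↦ TotalSpace.mk' E (E := TangentSpace I) z (Y z)) x →
    covDerivEnd cov J X Y x = 0

/-- `(g, φ, η, ξ)` is an almost quadratic metric `φ`-structure on `M`, with constants `a` and `b`. -/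
structure IsAlmostQuadraticMetricPhi [RiemannianBundle (fun x : M ↦ TangentSpace I x)] (a b : ℝ)
    (φ : ∀ x : M, TangentSpace I x →L[ℝ] TangentSpace I x)
    (η : ∀ x : M, TangentSpace I x →L[ℝ] ℝ) (ξ : ∀ x : M, TangentSpace I x) : Prop where
  b_ne_zero : b ≠ 0
  disc_ne_zero : a ^ 2 + 4 * b ≠ 0
  smooth_phi : IsSmoothEndField φ
  smooth_eta : IsSmoothOneForm η
  smooth_xi : IsSmoothField ξ
  unit_xi : ∀ x : M, ‖ξ x‖ = 1
  phi_xi : ∀ x : M, φ x (ξ x) = 0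
  phi_sq : ∀ (x : M) (v : TangentSpace I x),
    φ x (φ x v) = a • φ x v + b • (v - η x v • ξ x)
  phi_symm : ∀ (x : M) (v w : TangentSpace I x), inner ℝ (φ x v) w = inner ℝ v (φ x w)

end Connection

section Hypersurface

variable {E : Type*} [NormedAddCommGroup E] [NormedSpace ℝ E] [FiniteDimensional ℝ E]
  {H : Type*} [TopologicalSpace H] {I : ModelWithCorners ℝ E H}
  {M : Type*} [TopologicalSpace M] [ChartedSpace H M] [IsManifold I ∞ M]
  {E' : Type*} [NormedAddCommGroup E'] [NormedSpace ℝ E'] [FiniteDimensional ℝ E']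
  {H' : Type*} [TopologicalSpace H'] {I' : ModelWithCorners ℝ E' H'}
  {N : Type*} [TopologicalSpace N] [ChartedSpace H' N] [IsManifold I' ∞ N]

variable (I) in
/-- The covariant derivative `v ↦ ∇_v V` at `x` of a vector field `V` along a map `f : M → N`
(the pull-back of the connection of `N`). If `V = ∑ Vⁱ · eᵢ ∘ f`, where `(eᵢ)` is the coordinate
frame of `N` at `f x`, then `∇_v V = ∑ dVⁱ(v) eᵢ + ∑ Vⁱ(x) ∇_{df v} eᵢ`; here
`extend E' (V x)` is the field `∑ Vⁱ(x) eᵢ` near `f x`. -/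
def covDerivAlong (cov : CovariantDerivative I' E' (fun y : N ↦ TangentSpace I' y)) (f : M → N)
    (V : ∀ x : M, TangentSpace I' (f x)) (x : M) :
    TangentSpace I x →L[ℝ] TangentSpace I' (f x) :=
  ((trivializationAt E' (fun y : N ↦ TangentSpace I' y) (f x)).symmL ℝ (f x)) ∘L
      (mfderiv I 𝓘(ℝ, E') (fun z : M ↦
        (trivializationAt E' (fun y : N ↦ TangentSpace I' y) (f x) ⟨f z, V z⟩).2) x)
    + (cov (FiberBundle.extend E' (V x)) (f x)) ∘L (mfderiv I I' f x)

variable [RiemannianBundle (fun x : M ↦ TangentSpace I x)]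
  [RiemannianBundle (fun y : N ↦ TangentSpace I' y)]

/-- `f : M → N` is a smooth isometric immersion (the metric of `M` is the induced one), and `ν` is
a smooth unit normal vector field along `f`. -/
structure IsImmersionWithNormal (f : M → N) (ν : ∀ x : M, TangentSpace I' (f x)) : Prop where
  smooth : ContMDiff I I' ∞ f
  isometric : ∀ (x : M) (v w : TangentSpace I x),
    inner ℝ (mfderiv I I' f x v) (mfderiv I I' f x w) = inner ℝ v w
  smooth_normal : ContMDiff I (I'.prod 𝓘(ℝ, E')) ∞
    (fun x ↦ TotalSpace.mk' E' (E := fun y : N ↦ TangentSpace I' y) (f x) (ν x))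
  unit_normal : ∀ x : M, ‖ν x‖ = 1
  normal : ∀ (x : M) (v : TangentSpace I x), inner ℝ (mfderiv I I' f x v) (ν x) = 0

instance (x : M) : FiniteDimensional ℝ (TangentSpace I x) :=
  inferInstanceAs (FiniteDimensional ℝ E)

/-- The shape operator: `df (A v)` is the tangential part of `-∇_v ν`, that is,
`g(A v, w) = -⟨∇_v ν, df w⟩`. -/
def shapeOperator (cov : CovariantDerivative I' E' (fun y : N ↦ TangentSpace I' y)) (f : M → N)
    (ν : ∀ x : M, TangentSpace I' (f x)) (x : M) : TangentSpace I x →L[ℝ] TangentSpace I x :=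
  -(LinearMap.toContinuousLinearMap
    ((LinearMap.adjoint (mfderiv I I' f x).toLinearMap) ∘ₗ
      (covDerivAlong I cov f ν x).toLinearMap))

/-- The second fundamental form `h(Y, Z) = ⟨∇_Y (df Z), ν⟩` of vector fields `Y`, `Z` on `M`: the
normal component in the Gauss formula. -/
def secondFundamentalForm (cov : CovariantDerivative I' E' (fun y : N ↦ TangentSpace I' y))
    (f : M → N) (ν : ∀ x : M, TangentSpace I' (f x)) (Y Z : ∀ x : M, TangentSpace I x) (x : M) : ℝ :=
  inner ℝ (covDerivAlong I cov f (fun z ↦ mfderiv I I' f z (Z z)) x (Y x)) (ν x)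

/-- The second fundamental form is parallel: `X (h(Y, Z)) = h(∇_X Y, Z) + h(Y, ∇_X Z)` for all
smooth vector fields `X`, `Y`, `Z` on `M`. -/
def IsParallelSecondFundamentalForm
    (cov' : CovariantDerivative I' E' (fun y : N ↦ TangentSpace I' y))
    (cov : CovariantDerivative I E (fun x : M ↦ TangentSpace I x))
    (f : M → N) (ν : ∀ x : M, TangentSpace I' (f x)) : Prop :=
  ∀ X Y Z : ∀ x : M, TangentSpace I x, IsSmoothField X → IsSmoothField Y → IsSmoothField Z →
    ∀ x : M, mfderiv I 𝓘(ℝ, ℝ) (secondFundamentalForm cov' f ν Y Z) x (X x) =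
      secondFundamentalForm cov' f ν (fun z ↦ cov Y z (X z)) Z x
        + secondFundamentalForm cov' f ν Y (fun z ↦ cov Z z (X z)) x

/-- The isometrically immersed hypersurface `f : M → N` with unit normal `ν` is a quadratic metric
`φ`-hypersurface of `(N, J)`: the tensors in the decompositions `J X = φ X + η(X) ν`,
`J ν = q ξ + p ν`, `J ξ = ν` form an almost quadratic metric `φ`-structure on `M`. -/
structure IsQuadraticMetricPhiHypersurface (p q : ℕ)
    (J : ∀ y : N, TangentSpace I' y →L[ℝ] TangentSpace I' y)
    (f : M → N) (ν : ∀ x : M, TangentSpace I' (f x))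
    (φ : ∀ x : M, TangentSpace I x →L[ℝ] TangentSpace I x)
    (η : ∀ x : M, TangentSpace I x →L[ℝ] ℝ) (ξ : ∀ x : M, TangentSpace I x) : Prop where
  hypersurface : IsImmersionWithNormal (I := I) (I' := I') f ν
  J_tangent : ∀ (x : M) (v : TangentSpace I x),
    J (f x) (mfderiv I I' f x v) = mfderiv I I' f x (φ x v) + η x v • ν x
  J_normal : ∀ x : M, J (f x) (ν x) = (q : ℝ) • mfderiv I I' f x (ξ x) + (p : ℝ) • ν x
  J_xi : ∀ x : M, J (f x) (mfderiv I I' f x (ξ x)) = ν x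
  quadratic : IsAlmostQuadraticMetricPhi (p : ℝ) (q : ℝ) φ η ξ

end Hypersurface

end MetallicHypersurface
end

/-! The result comes from differentiating the decompositions of `J` along the immersion. Pairing
them with ν and using the symmetry of `J` gives q = 1 and η = g(·, ξ). Since `J` is parallel, it
commutes with the derivative along `f` (`covDerivAlong_clm_apply`). Combined with the Gauss and
Weingarten formulas (`covDerivAlong_mfderiv`, `covDerivAlong_normal`), the decomposition of Jν then
yields ∇_v ξ = pAv - φAv tangentially and η ∘ A = 0 normally, while that of JY yields (∇_X φ)Y =
g(AX, Y)ξ + η(Y)AX.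

Differentiating ∇_Y ξ = pAY - φAY once more gives p∇_X(AY) - φ∇_X(AY) - g(AX, AY)ξ, because η(AY) =
0. The last term is symmetric in X and Y, so it disappears from the curvature, and [X,Y] = ∇_X Y -
∇_Y X turns the rest into covariant derivatives of A. If h is parallel, these derivatives vanish.

The preceding calculus rests on two facts: every field along `f` is locally a combination of
restricted ambient fields (`DiffAlongAt.induction`), and the derivative along `f` inherits the
symmetry of a torsion-free connection (`covDerivAlong_mfderiv_sub_swap`). -/

noncomputable section

namespace MetallicHypersurface

open Filter Topology VectorField

/-! ### The Lie bracket as a commutator of derivations on vector-valued functions. -/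

section LieBracketFunction

variable {E : Type*} [NormedAddCommGroup E] [NormedSpace ℝ E]
  {H : Type*} [TopologicalSpace H] {I : ModelWithCorners ℝ E H}
  {M : Type*} [TopologicalSpace M] [ChartedSpace H M] [IsManifold I ∞ M]
  {F : Type*} [NormedAddCommGroup F] [NormedSpace ℝ F]

/-- Chain rule: the pullback under the inverse chart applies the inverse of the chart's derivative
to the field, and this cancels the derivative of the inverse chart. -/
lemma mvfderiv_eq_fderiv_mpullbackWithin [I.Boundaryless] {u : M → F} {x z : M}
    (hz : z ∈ (extChartAt I x).source) (hu : MDifferentiableAt I 𝓘(ℝ, F) u z)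
    (X : ∀ x : M, TangentSpace I x) :
    mvfderiv I u z (X z) = fderiv ℝ (u ∘ (extChartAt I x).symm) (extChartAt I x z)
      (mpullbackWithin 𝓘(ℝ, E) I (extChartAt I x).symm X (Set.range I) (extChartAt I x z)) := by
  have hzt : extChartAt I x z ∈ (extChartAt I x).target := (extChartAt I x).map_source hz
  have hs : MDifferentiableAt 𝓘(ℝ, E) I (extChartAt I x).symm (extChartAt I x z) := by
    have := mdifferentiableWithinAt_extChartAt_symm (I := I) hzt
    rwa [I.range_eq_univ, mdifferentiableWithinAt_univ] at this
  have hz' : (extChartAt I x).symm (extChartAt I x z) = z := (extChartAt I x).left_inv hz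
  have hinv := isInvertible_mfderivWithin_extChartAt_symm (I := I) hzt
  rw [I.range_eq_univ, mfderivWithin_univ] at hinv
  have hu' : MDifferentiableAt I 𝓘(ℝ, F) u ((extChartAt I x).symm (extChartAt I x z)) := by
    rwa [hz']
  rw [← mfderiv_eq_fderiv, mfderiv_comp _ hu' hs, mpullbackWithin_apply, I.range_eq_univ,
    mfderivWithin_univ]
  have key := congr($(hinv.self_comp_inverse) (X ((extChartAt I x).symm (extChartAt I x z))))
  change _ = mfderiv I 𝓘(ℝ, F) u _ (mfderiv 𝓘(ℝ, E) I _ _ _)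
  erw [key]
  simp only [ContinuousLinearMap.id_apply]
  rw [hz']
  rfl

theorem mvfderiv_mlieBracket [CompleteSpace E] [I.Boundaryless] {u : M → F} {x : M}
    (hu : ContMDiffAt I 𝓘(ℝ, F) 2 u x) {X Y : ∀ x : M, TangentSpace I x}
    (hX : MDifferentiableAt I (I.prod 𝓘(ℝ, E)) (fun z ↦ TotalSpace.mk' E (E := TangentSpace I) z (X z)) x)
    (hY : MDifferentiableAt I (I.prod 𝓘(ℝ, E)) (fun z ↦ TotalSpace.mk' E (E := TangentSpace I) z (Y z)) x) :
    mvfderiv I u x (mlieBracket I X Y x) =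
      mvfderiv I (fun z ↦ mvfderiv I u z (Y z)) x (X x)
        - mvfderiv I (fun z ↦ mvfderiv I u z (X z)) x (Y x) := by
  set φ := extChartAt I x with hφ
  set X' := mpullbackWithin 𝓘(ℝ, E) I φ.symm X (Set.range I) with hX'
  set Y' := mpullbackWithin 𝓘(ℝ, E) I φ.symm Y (Set.range I) with hY'
  have dX : DifferentiableAt ℝ X' (φ x) := by
    have := MDifferentiableWithinAt.differentiableWithinAt_mpullbackWithin_vectorField
      (s := Set.univ) hX.mdifferentiableWithinAt
    rw [Set.preimage_univ, Set.univ_inter] at this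
    exact this.differentiableAt (by rw [I.range_eq_univ]; exact univ_mem)
  have dY : DifferentiableAt ℝ Y' (φ x) := by
    have := MDifferentiableWithinAt.differentiableWithinAt_mpullbackWithin_vectorField
      (s := Set.univ) hY.mdifferentiableWithinAt
    rw [Set.preimage_univ, Set.univ_inter] at this
    exact this.differentiableAt (by rw [I.range_eq_univ]; exact univ_mem)
  have du : ContDiffAt ℝ 2 (u ∘ φ.symm) (φ x) := by
    have hs : ContMDiffAt 𝓘(ℝ, E) I 2 φ.symm (φ x) :=
      (contMDiffOn_extChartAt_symm (n := 2) x).contMDiffAt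
        (extChartAt_target_mem_nhds x)
    refine (ContMDiffAt.comp _ ?_ hs).contDiffAt
    rwa [hφ, extChartAt_to_inv x]
  have hu' : ∀ᶠ z in 𝓝 x, ContMDiffAt I 𝓘(ℝ, F) 2 u z :=
    (contMDiffAt_iff_contMDiffAt_nhds (by simp)).1 hu
  have hev : ∀ᶠ z in 𝓝 x, z ∈ φ.source ∧ MDifferentiableAt I 𝓘(ℝ, F) u z := by
    filter_upwards [extChartAt_source_mem_nhds (I := I) x, hu'] with z h1 h2
    exact ⟨h1, h2.mdifferentiableAt (by simp)⟩
  have dφ : MDifferentiableAt I 𝓘(ℝ, E) φ x := mdifferentiableAt_extChartAt (mem_chart_source H x)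
  -- The chart formula is used twice: near `x` to recognise the inner derivative as `G ∘ φ`, then at
  -- `x` itself for the outer derivative.
  have key : ∀ Z : ∀ x : M, TangentSpace I x,
      DifferentiableAt ℝ (mpullbackWithin 𝓘(ℝ, E) I φ.symm Z (Set.range I)) (φ x) → ∀ W, 
      mvfderiv I (fun z ↦ mvfderiv I u z (Z z)) x (W x) =
      fderiv ℝ (fun w ↦ fderiv ℝ (u ∘ φ.symm) w (mpullbackWithin 𝓘(ℝ, E) I φ.symm Z (Set.range I) w))
        (φ x) (mpullbackWithin 𝓘(ℝ, E) I φ.symm W (Set.range I) (φ x)) := by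
    intro Z dZ W
    set G : E → F := fun w ↦
      fderiv ℝ (u ∘ φ.symm) w (mpullbackWithin 𝓘(ℝ, E) I φ.symm Z (Set.range I) w) with hG
    have dG : DifferentiableAt ℝ G (φ x) :=
      ((du.fderiv_right (m := 1) (by norm_num)).differentiableAt (by simp)).clm_apply dZ
    have he : (fun z ↦ mvfderiv I u z (Z z)) =ᶠ[𝓝 x] G ∘ φ := by
      filter_upwards [hev] with z hz
      exact mvfderiv_eq_fderiv_mpullbackWithin hz.1 hz.2 Z
    have dGφ : MDifferentiableAt I 𝓘(ℝ, F) (fun z ↦ mvfderiv I u z (Z z)) x :=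
      (dG.mdifferentiableAt.comp x dφ).congr_of_eventuallyEq he
    rw [mvfderiv_eq_fderiv_mpullbackWithin (mem_extChartAt_source x) dGφ W]
    congr 1
    refine Filter.EventuallyEq.fderiv_eq ?_
    filter_upwards [extChartAt_target_mem_nhds (I := I) x,
      (continuousAt_extChartAt_symm x).preimage_mem_nhds
        (by rw [extChartAt_to_inv]; exact he)] with w hw hw'
    have : G (φ (φ.symm w)) = G w := by rw [φ.right_inv hw]
    exact hw'.trans this
  rw [key Y dY, key X dX, mvfderiv_eq_fderiv_mpullbackWithin (mem_extChartAt_source x)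
    (hev.self_of_nhds.2)]
  refine Eq.trans ?_ (fderiv_apply_lieBracket du (by simp) dY dX)
  refine congrArg (fderiv ℝ (u ∘ φ.symm) (φ x)) ?_
  -- At its centre the chart has identity derivative, so the bracket on `M` is the vector-space
  -- bracket of the pulled-back fields.
  rw [mpullbackWithin_apply, extChartAt_to_inv, mfderivWithin_range_extChartAt_symm]
  rw [← mlieBracketWithin_univ, mlieBracketWithin_apply, mfderiv_extChartAt_self]
  erw [ContinuousLinearMap.inverse_id]
  rw [Set.preimage_univ, Set.univ_inter]
  change lieBracketWithin ℝ X' Y' (Set.range I) (φ x) = lieBracket ℝ X' Y' (φ x)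
  rw [I.range_eq_univ]
  exact congrFun lieBracketWithin_univ (φ x)

end LieBracketFunction

/-! ### Fields along a map: linearity, Leibniz rule and locality of their derivative. -/

section Along

variable {E : Type*} [NormedAddCommGroup E] [NormedSpace ℝ E]
  {H : Type*} [TopologicalSpace H] {I : ModelWithCorners ℝ E H}
  {M : Type*} [TopologicalSpace M] [ChartedSpace H M]
  {E' : Type*} [NormedAddCommGroup E'] [NormedSpace ℝ E']
  {H' : Type*} [TopologicalSpace H'] {I' : ModelWithCorners ℝ E' H'}
  {N : Type*} [TopologicalSpace N] [ChartedSpace H' N] [IsManifold I' ∞ N]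

variable (I I') in
/-- Differentiability at `x` of a vector field along the map `f : M → N`. -/
abbrev DiffAlongAt (f : M → N) (V : ∀ x : M, TangentSpace I' (f x)) (x : M) : Prop :=
  MDifferentiableAt I (I'.prod 𝓘(ℝ, E'))
    (fun z ↦ TotalSpace.mk' E' (E := TangentSpace I') (f z) (V z)) x

variable (I') in
/-- The coordinates at `z`, in the coordinate frame centered at `f x`, of a vector field along
the map `f : M → N`. -/
def coordAlong (f : M → N) (V : ∀ x : M, TangentSpace I' (f x)) (x z : M) : E' :=
  (trivializationAt E' (TangentSpace I') (f x) ⟨f z, V z⟩).2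

variable {f : M → N} {V W : ∀ x : M, TangentSpace I' (f x)} {x : M}
  (cov : CovariantDerivative I' E' (fun y : N ↦ TangentSpace I' y))

lemma covDerivAlong_apply (v : TangentSpace I x) :
    covDerivAlong I cov f V x v =
      (trivializationAt E' (TangentSpace I') (f x)).symmL ℝ (f x)
          (mvfderiv I (coordAlong I' f V x) x v)
        + cov (FiberBundle.extend E' (V x)) (f x) (mfderiv I I' f x v) := rfl

lemma diffAlongAt_iff :
    DiffAlongAt I I' f V x ↔ MDifferentiableAt I I' f x ∧
      MDifferentiableAt I 𝓘(ℝ, E') (coordAlong I' f V x) x :=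
  mdifferentiableAt_totalSpace ..

lemma eventually_mem_baseSet (hf : MDifferentiableAt I I' f x) :
    ∀ᶠ z in 𝓝 x, f z ∈ (trivializationAt E' (TangentSpace I') (f x)).baseSet :=
  hf.continuousAt.preimage_mem_nhds
    ((trivializationAt E' (TangentSpace I') (f x)).open_baseSet.mem_nhds
      (FiberBundle.mem_baseSet_trivializationAt' (f x)))

lemma coordAlong_add (hf : MDifferentiableAt I I' f x) :
    coordAlong I' f (fun z ↦ V z + W z) x =ᶠ[𝓝 x]
      fun z ↦ coordAlong I' f V x z + coordAlong I' f W x z := by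
  filter_upwards [eventually_mem_baseSet hf] with z hz
  exact ((trivializationAt E' (TangentSpace I') (f x)).linear ℝ hz).1 _ _

lemma coordAlong_smul (g : M → ℝ) (hf : MDifferentiableAt I I' f x) :
    coordAlong I' f (fun z ↦ g z • V z) x =ᶠ[𝓝 x] fun z ↦ g z • coordAlong I' f V x z := by
  filter_upwards [eventually_mem_baseSet hf] with z hz
  exact ((trivializationAt E' (TangentSpace I') (f x)).linear ℝ hz).2 _ _

lemma DiffAlongAt.add (hV : DiffAlongAt I I' f V x) (hW : DiffAlongAt I I' f W x) :
    DiffAlongAt I I' f (fun z ↦ V z + W z) x := by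
  rw [diffAlongAt_iff] at hV hW ⊢
  exact ⟨hV.1, (hV.2.add hW.2).congr_of_eventuallyEq (coordAlong_add hV.1)⟩

lemma DiffAlongAt.smul {g : M → ℝ} (hg : MDifferentiableAt I 𝓘(ℝ, ℝ) g x)
    (hV : DiffAlongAt I I' f V x) : DiffAlongAt I I' f (fun z ↦ g z • V z) x := by
  rw [diffAlongAt_iff] at hV ⊢
  exact ⟨hV.1, (hg.smul hV.2).congr_of_eventuallyEq (coordAlong_smul g hV.1)⟩

lemma DiffAlongAt.congr (hV : DiffAlongAt I I' f V x) (h : ∀ᶠ z in 𝓝 x, W z = V z) :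
    DiffAlongAt I I' f W x :=
  MDifferentiableAt.congr_of_eventuallyEq hV (h.mono fun z hz ↦ congrArg (TotalSpace.mk (f z)) hz)

lemma DiffAlongAt.comp {Y : ∀ y : N, TangentSpace I' y} (hf : MDifferentiableAt I I' f x)
    (hY : MDifferentiableAt I' (I'.prod 𝓘(ℝ, E'))
      (fun y ↦ TotalSpace.mk' E' (E := TangentSpace I') y (Y y)) (f x)) :
    DiffAlongAt I I' f (fun z ↦ Y (f z)) x :=
  MDifferentiableAt.comp x hY hf

lemma mvfderiv_congr {F : Type*} [NormedAddCommGroup F] [NormedSpace ℝ F] {u w : M → F}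
    (h : u =ᶠ[𝓝 x] w) : mvfderiv I u x = mvfderiv I w x := by
  have := h.mfderiv_eq (I := I) (I' := 𝓘(ℝ, F))
  ext v
  exact congr($this v)

/-- Near `y` the extension is given by the inverse trivialization, which is linear on each fibre;
locality of the connection transfers this linearity to the derivative at `y`. It makes the
zeroth-order term of `covDerivAlong` additive in the field. -/
lemma cov_extend_add {y : N} (v w : TangentSpace I' y) :
    cov (FiberBundle.extend E' (v + w)) y =
      cov (FiberBundle.extend E' v) y + cov (FiberBundle.extend E' w) y := by
  have hv := FiberBundle.mdifferentiableAt_extend I' E' v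
  have hw := FiberBundle.mdifferentiableAt_extend I' E' w
  rw [← cov.isCovariantDerivativeOn.add hv hw]
  refine cov.isCovariantDerivativeOn.congr_of_eventuallyEq (s := Set.univ)
    (FiberBundle.mdifferentiableAt_extend ..) (mdifferentiableAt_add_section hv hw) univ_mem ?_
  have hy := FiberBundle.mem_baseSet_trivializationAt' (F := E') (E := TangentSpace I') y
  filter_upwards [(trivializationAt E' (TangentSpace I') y).open_baseSet.mem_nhds hy] with z hz
  simp only [FiberBundle.extend, Pi.add_apply, ← Trivialization.coe_symmₗ (R := ℝ) _ hz]
  rw [← map_add]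
  exact congrArg _ (((trivializationAt E' (TangentSpace I') y).linear ℝ hy).1 v w)

lemma cov_extend_smul {y : N} (a : ℝ) (v : TangentSpace I' y) :
    cov (FiberBundle.extend E' (a • v)) y = a • cov (FiberBundle.extend E' v) y := by
  have hv := FiberBundle.mdifferentiableAt_extend I' E' v
  rw [← cov.isCovariantDerivativeOn.smul_const a hv]
  refine cov.isCovariantDerivativeOn.congr_of_eventuallyEq (s := Set.univ)
    (FiberBundle.mdifferentiableAt_extend ..)
    (MDifferentiableAt.smul_section (f := fun _ ↦ a) mdifferentiableAt_const hv) univ_mem ?_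
  have hy := FiberBundle.mem_baseSet_trivializationAt' (F := E') (E := TangentSpace I') y
  filter_upwards [(trivializationAt E' (TangentSpace I') y).open_baseSet.mem_nhds hy] with z hz
  simp only [FiberBundle.extend, Pi.smul_apply, ← Trivialization.coe_symmₗ (R := ℝ) _ hz]
  rw [← map_smul]
  exact congrArg _ (((trivializationAt E' (TangentSpace I') y).linear ℝ hy).2 a v)

lemma covDerivAlong_add (hV : DiffAlongAt I I' f V x) (hW : DiffAlongAt I I' f W x)
    (v : TangentSpace I x) :
    covDerivAlong I cov f (fun z ↦ V z + W z) x v =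
      covDerivAlong I cov f V x v + covDerivAlong I cov f W x v := by
  have hV' := diffAlongAt_iff.1 hV
  have hW' := diffAlongAt_iff.1 hW
  simp only [covDerivAlong_apply]
  rw [mvfderiv_congr (coordAlong_add hV'.1), mvfderiv_fun_add hV'.2 hW'.2, cov_extend_add]
  simp only [add_apply, map_add]
  abel

omit [TopologicalSpace M] in
lemma symmL_coordAlong_self :
    (trivializationAt E' (TangentSpace I') (f x)).symmL ℝ (f x) (coordAlong I' f V x x) = V x := by
  have h := FiberBundle.mem_baseSet_trivializationAt' (F := E') (E := TangentSpace I') (f x)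
  rw [coordAlong, ← Trivialization.continuousLinearMapAt_apply_of_mem (R := ℝ) _ h]
  exact
  (trivializationAt E' (TangentSpace I') (f x)).symmL_continuousLinearMapAt
      (FiberBundle.mem_baseSet_trivializationAt' (f x)) (V x)

lemma covDerivAlong_smul {g : M → ℝ} (hg : MDifferentiableAt I 𝓘(ℝ, ℝ) g x)
    (hV : DiffAlongAt I I' f V x) (v : TangentSpace I x) :
    covDerivAlong I cov f (fun z ↦ g z • V z) x v =
      g x • covDerivAlong I cov f V x v + mvfderiv I g x v • V x := by
  have hV' := diffAlongAt_iff.1 hV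
  simp only [covDerivAlong_apply]
  rw [mvfderiv_congr (coordAlong_smul g hV'.1), mvfderiv_fun_smul hg hV'.2, cov_extend_smul]
  simp only [add_apply, smul_apply,
    ContinuousLinearMap.smulRight_apply, map_add, map_smul, symmL_coordAlong_self, smul_add]
  abel

lemma covDerivAlong_congr (h : ∀ᶠ z in 𝓝 x, W z = V z) :
    covDerivAlong I cov f W x = covDerivAlong I cov f V x := by
  ext v
  simp only [covDerivAlong_apply]
  rw [mvfderiv_congr (h.mono fun z hz ↦ ?_), h.self_of_nhds]
  simp only [coordAlong, hz]

end Along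

/-! ### Chain rule, parallel endomorphisms and metric compatibility along a map. -/

section AlongRules

variable {E : Type*} [NormedAddCommGroup E] [NormedSpace ℝ E]
  {H : Type*} [TopologicalSpace H] {I : ModelWithCorners ℝ E H}
  {M : Type*} [TopologicalSpace M] [ChartedSpace H M]
  {E' : Type*} [NormedAddCommGroup E'] [NormedSpace ℝ E'] [FiniteDimensional ℝ E']
  {H' : Type*} [TopologicalSpace H'] {I' : ModelWithCorners ℝ E' H'}
  {N : Type*} [TopologicalSpace N] [ChartedSpace H' N] [IsManifold I' ∞ N]
  {f : M → N} {V W : ∀ x : M, TangentSpace I' (f x)} {x : M}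
  (cov : CovariantDerivative I' E' (fun y : N ↦ TangentSpace I' y))

omit [FiniteDimensional ℝ E'] in
lemma coordAlong_extend_eventually_const {y : N} (v : TangentSpace I' y) :
    coordAlong I' (fun z : N ↦ z) (FiberBundle.extend E' v) y =ᶠ[𝓝 y]
      fun _ ↦ (trivializationAt E' (TangentSpace I') y ⟨y, v⟩).2 := by
  have hy := FiberBundle.mem_baseSet_trivializationAt' (F := E') (E := TangentSpace I') y
  filter_upwards [(trivializationAt E' (TangentSpace I') y).open_baseSet.mem_nhds hy] with z hz
  simp only [coordAlong, FiberBundle.extend]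
  rw [Trivialization.apply_mk_symm _ hz]

/-- Both sides obey the same Leibniz rule, so their difference is tensorial and may be tested on the
extension of `Y y`. Its coordinates are locally constant, so only the connection term remains. -/
lemma covDerivAlong_id {Y : ∀ y : N, TangentSpace I' y} {y : N}
    (hY : MDifferentiableAt I' (I'.prod 𝓘(ℝ, E'))
      (fun y ↦ TotalSpace.mk' E' (E := TangentSpace I') y (Y y)) y) (v : TangentSpace I' y) :
    covDerivAlong I' cov (fun z : N ↦ z) Y y v = cov Y y v := by
  have hT : TensorialAt I' E' (fun Y : ∀ y : N, TangentSpace I' y ↦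
      covDerivAlong I' cov (fun z : N ↦ z) Y y v - cov Y y v) y := by
    constructor
    · intro g σ hg hσ
      have h1 := covDerivAlong_smul (f := fun z : N ↦ z) cov hg hσ v
      have h2 := congr($(cov.isCovariantDerivativeOn.leibniz hσ hg) v)
      change covDerivAlong I' cov (fun z : N ↦ z) (fun z ↦ g z • σ z) y v - _ = _
      rw [h1, h2]
      simp only [add_apply, smul_apply, ContinuousLinearMap.smulRight_apply, smul_sub]
      abel
    · intro σ σ' hσ hσ'
      have h1 := covDerivAlong_add (f := fun z : N ↦ z) cov hσ hσ' v
      have h2 := congr($(cov.isCovariantDerivativeOn.add hσ hσ') v)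
      change covDerivAlong I' cov (fun z : N ↦ z) (fun z ↦ σ z + σ' z) y v - _ = _
      rw [h1, h2]
      simp only [add_apply]
      abel
  have h := hT.pointwise hY (FiberBundle.mdifferentiableAt_extend I' E' (Y y))
    (FiberBundle.extend_apply_self _ (Y y)).symm
  rw [← sub_eq_zero]
  refine h.trans ?_
  rw [covDerivAlong_apply, mvfderiv_congr (coordAlong_extend_eventually_const (Y y)),
    mvfderiv_const, FiberBundle.extend_apply_self]
  have : mfderiv I' I' (fun z : N ↦ z) y = ContinuousLinearMap.id ℝ _ := mfderiv_id
  rw [this]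
  simp

lemma covDerivAlong_comp {Y : ∀ y : N, TangentSpace I' y}
    (hf : MDifferentiableAt I I' f x)
    (hY : MDifferentiableAt I' (I'.prod 𝓘(ℝ, E'))
      (fun y ↦ TotalSpace.mk' E' (E := TangentSpace I') y (Y y)) (f x)) (v : TangentSpace I x) :
    covDerivAlong I cov f (fun z ↦ Y (f z)) x v = cov Y (f x) (mfderiv I I' f x v) := by
  rw [← covDerivAlong_id cov hY, covDerivAlong_apply, covDerivAlong_apply]
  have h1 : mvfderiv I (coordAlong I' f (fun z ↦ Y (f z)) x) x v =
      mvfderiv I' (coordAlong I' (fun z : N ↦ z) Y (f x)) (f x) (mfderiv I I' f x v) :=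
    mfderiv_comp_apply x (diffAlongAt_iff (f := fun z : N ↦ z).1 hY).2 hf v
  have h2 : mfderiv I' I' (fun z : N ↦ z) (f x) = ContinuousLinearMap.id ℝ _ := mfderiv_id
  rw [h1, h2]
  rfl

/-- Near `x`, vector fields along `f` are combinations, with functions on `M` as coefficients, of
vector fields of the target restricted to `f`. -/
theorem DiffAlongAt.induction {P : (∀ x : M, TangentSpace I' (f x)) → Prop}
    (hcomp : ∀ Y : ∀ y : N, TangentSpace I' y, MDifferentiableAt I' (I'.prod 𝓘(ℝ, E'))
      (fun y ↦ TotalSpace.mk' E' (E := TangentSpace I') y (Y y)) (f x) → P (fun z ↦ Y (f z)))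
    (hadd : ∀ V W, DiffAlongAt I I' f V x → DiffAlongAt I I' f W x → P V → P W →
      P (fun z ↦ V z + W z))
    (hsmul : ∀ (g : M → ℝ) V, MDifferentiableAt I 𝓘(ℝ, ℝ) g x → DiffAlongAt I I' f V x → P V →
      P (fun z ↦ g z • V z))
    (hcongr : ∀ V W, DiffAlongAt I I' f V x → (∀ᶠ z in 𝓝 x, W z = V z) → P V → P W)
    (hV : DiffAlongAt I I' f V x) : P V := by
  classical
  obtain ⟨hf, hc⟩ := diffAlongAt_iff.1 hV
  let b := Module.finBasis ℝ E'
  let e := trivializationAt E' (TangentSpace I' : N → Type _) (f x)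
  -- The coordinate frame near `f x`; the coefficients `g i` are the coordinates of `V` in it.
  let s : ∀ i, ∀ y : N, TangentSpace I' y := fun i ↦
    FiberBundle.extend E' (e.symmL ℝ (f x) (b i))
  let g : ∀ i, M → ℝ := fun i z ↦ b.repr (coordAlong I' f V x z) i
  have hs : ∀ i, MDifferentiableAt I' (I'.prod 𝓘(ℝ, E'))
      (fun y ↦ TotalSpace.mk' E' (E := TangentSpace I') y (s i y)) (f x) :=
    fun i ↦ FiberBundle.mdifferentiableAt_extend ..
  have hg : ∀ i, MDifferentiableAt I 𝓘(ℝ, ℝ) (g i) x := fun i ↦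
    (LinearMap.toContinuousLinearMap (b.coord i)).mdifferentiableAt.comp x hc
  have hsum : ∀ t : Finset (Fin (Module.finrank ℝ E')),
      DiffAlongAt I I' f (fun z ↦ ∑ i ∈ t, g i z • s i (f z)) x ∧
        P (fun z ↦ ∑ i ∈ t, g i z • s i (f z)) := by
    intro t
    induction t using Finset.induction_on with
    | empty =>
      have h0 : MDifferentiableAt I' (I'.prod 𝓘(ℝ, E'))
        (fun y ↦ TotalSpace.mk' E' (E := TangentSpace I') y (0 : TangentSpace I' y)) (f x) :=
        mdifferentiableAt_zeroSection ..
      simp only [Finset.sum_empty]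
      exact ⟨h0.comp x hf, hcomp _ h0⟩
    | insert i t hi ih =>
      have hd : DiffAlongAt I I' f (fun z ↦ g i z • s i (f z)) x :=
        (DiffAlongAt.comp hf (hs i)).smul (hg i)
      simp only [Finset.sum_insert hi]
      exact ⟨hd.add ih.1,
        hadd _ _ hd ih.1 (hsmul _ _ (hg i) (DiffAlongAt.comp hf (hs i)) (hcomp _ (hs i))) ih.2⟩
  refine hcongr _ _ (hsum Finset.univ).1 ?_ (hsum Finset.univ).2
  filter_upwards [eventually_mem_baseSet hf] with z hz
  have hy := FiberBundle.mem_baseSet_trivializationAt' (F := E') (E := TangentSpace I') (f x)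
  have h1 : ∀ i, s i (f z) = e.symmL ℝ (f z) (b i) := by
    intro i
    simp only [s, FiberBundle.extend]
    rw [← Trivialization.continuousLinearMapAt_apply_of_mem (R := ℝ) _ hy,
      Trivialization.continuousLinearMapAt_symmL _ hy, ← Trivialization.coe_symmₗ (R := ℝ) _ hz]
    rfl
  simp only [h1, ← map_smul, ← map_sum, g, Module.Basis.sum_repr]
  rw [coordAlong, ← Trivialization.continuousLinearMapAt_apply_of_mem (R := ℝ) _ hz]
  exact (Trivialization.symmL_continuousLinearMapAt _ hz (V z)).symm

section EndField

variable {J : ∀ y : N, TangentSpace I' y →L[ℝ] TangentSpace I' y}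

omit [FiniteDimensional ℝ E'] in
lemma DiffAlongAt.clm_apply (hJ : IsSmoothEndField J) (hV : DiffAlongAt I I' f V x) :
    DiffAlongAt I I' f (fun z ↦ J (f z) (V z)) x := by
  have hf := (diffAlongAt_iff.1 hV).1
  have hJ' : MDifferentiableAt I' (I'.prod 𝓘(ℝ, E' →L[ℝ] E'))
    (fun x ↦ TotalSpace.mk' (E' →L[ℝ] E')
      (E := fun x : N ↦ TangentSpace I' x →L[ℝ] TangentSpace I' x) x (J x)) (f x) :=
    (hJ (f x)).mdifferentiableAt (by simp)
  exact MDifferentiableAt.clm_bundle_apply (hJ'.comp x hf) hV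

/-- For restricted ambient fields this is the parallelism of `J`; both sides respect the operations
of `DiffAlongAt.induction`. -/
theorem covDerivAlong_clm_apply (hJ : IsSmoothEndField J)
    (hpar : ∀ (X Y : ∀ x : N, TangentSpace I' x) (x : N),
      MDifferentiableAt I' (I'.prod 𝓘(ℝ, E'))
        (fun z ↦ TotalSpace.mk' E' (E := TangentSpace I') z (Y z)) x → covDerivEnd cov J X Y x = 0)
    (hV : DiffAlongAt I I' f V x) (v : TangentSpace I x) :
    covDerivAlong I cov f (fun z ↦ J (f z) (V z)) x v = J (f x) (covDerivAlong I cov f V x v) := by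
  refine hV.induction (P := fun V ↦ covDerivAlong I cov f (fun z ↦ J (f z) (V z)) x v =
    J (f x) (covDerivAlong I cov f V x v)) ?_ ?_ ?_ ?_
  · intro Y hY
    have hf := (diffAlongAt_iff.1 hV).1
    rw [covDerivAlong_comp cov hf hY]
    have hJY := DiffAlongAt.clm_apply (I := I') (f := fun z : N ↦ z) hJ hY
    rw [covDerivAlong_comp (Y := fun y ↦ J y (Y y)) cov hf hJY]
    -- Parallelism is stated for direction fields, so the single vector df(v) is extended.
    have := hpar (FiberBundle.extend E' (mfderiv I I' f x v)) Y (f x) hY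
    simp only [covDerivEnd, FiberBundle.extend_apply_self] at this
    exact sub_eq_zero.1 this
  · intro V W hV hW h1 h2
    rw [covDerivAlong_add cov hV hW, map_add, ← h1, ← h2,
      ← covDerivAlong_add cov (hV.clm_apply hJ) (hW.clm_apply hJ)]
    simp only [map_add]
  · intro g V hg hV h
    rw [covDerivAlong_smul cov hg hV, map_add, map_smul, map_smul, ← h,
      ← covDerivAlong_smul cov hg (hV.clm_apply hJ)]
    simp only [map_smul]
  · intro V W hV hVW h
    rw [covDerivAlong_congr cov hVW, ← h]
    rw [covDerivAlong_congr cov (hVW.mono fun z hz ↦ by rw [hz])]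

end EndField

section Metric

variable [RiemannianBundle (fun y : N ↦ TangentSpace I' y)]
  [IsContMDiffRiemannianBundle I' ∞ E' (fun y : N ↦ TangentSpace I' y)]

omit [FiniteDimensional ℝ E'] in
lemma DiffAlongAt.inner (hV : DiffAlongAt I I' f V x) (hW : DiffAlongAt I I' f W x) :
    MDifferentiableAt I 𝓘(ℝ, ℝ) (fun z ↦ inner ℝ (V z) (W z)) x :=
  MDifferentiableAt.inner_bundle (E := fun y : N ↦ TangentSpace I' y) hV hW

/-- Induction on each of the two fields reduces the claim to ambient fields, where it is metric
compatibility on `N` and the chain rule. -/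
theorem mvfderiv_inner_along
    (hcov : CovariantDerivative.IsMetricCompatible (V := fun y : N ↦ TangentSpace I' y) cov)
    (hV : DiffAlongAt I I' f V x) (hW : DiffAlongAt I I' f W x) (v : TangentSpace I x) :
    mvfderiv I (fun z ↦ inner ℝ (V z) (W z)) x v =
      inner ℝ (covDerivAlong I cov f V x v) (W x) + inner ℝ (V x) (covDerivAlong I cov f W x v) := by
  have hf := (diffAlongAt_iff.1 hV).1
  refine hV.induction (P := fun V ↦ mvfderiv I (fun z ↦ inner ℝ (V z) (W z)) x v =
      inner ℝ (covDerivAlong I cov f V x v) (W x)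
        + inner ℝ (V x) (covDerivAlong I cov f W x v)) ?_ ?_ ?_ ?_
  · intro Y hY
    have hYf : DiffAlongAt I I' f (fun z ↦ Y (f z)) x := .comp hf hY
    refine hW.induction (P := fun W ↦ mvfderiv I (fun z ↦ inner ℝ (Y (f z)) (W z)) x v =
      inner ℝ (covDerivAlong I cov f (fun z ↦ Y (f z)) x v) (W x)
        + inner ℝ (Y (f x)) (covDerivAlong I cov f W x v)) ?_ ?_ ?_ ?_
    · intro Z hZ
      rw [covDerivAlong_comp cov hf hY, covDerivAlong_comp cov hf hZ]
      have h := hcov.mvfderiv_inner_eq (FiberBundle.extend E' (mfderiv I I' f x v)) hY hZ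
      simp only [FiberBundle.extend_apply_self] at h
      rw [← h]
      exact mfderiv_comp_apply x
        (MDifferentiableAt.inner_bundle (E := fun y : N ↦ TangentSpace I' y) hY hZ) hf v
    · intro V W hV hW h1 h2
      simp only [inner_add_right]
      rw [mvfderiv_fun_add (hYf.inner hV) (hYf.inner hW), covDerivAlong_add cov hV hW, add_apply,
        h1, h2, inner_add_right]
      ring
    · intro g V hg hV h
      simp only [inner_smul_right]
      rw [mvfderiv_fun_mul hg (hYf.inner hV), covDerivAlong_smul cov hg hV]
      simp only [add_apply, smul_apply, h, smul_eq_mul, inner_add_right, inner_smul_right]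
      ring
    · intro V W hV hVW h
      rw [covDerivAlong_congr cov hVW, hVW.self_of_nhds, ← h,
        mvfderiv_congr (w := fun z ↦ inner ℝ (Y (f z)) (V z))
          (hVW.mono fun z hz ↦ by simp only [hz])]
  · intro V U hV hU h1 h2
    simp only [inner_add_left]
    rw [mvfderiv_fun_add (hV.inner hW) (hU.inner hW), covDerivAlong_add cov hV hU, add_apply,
      h1, h2, inner_add_left]
    ring
  · intro g V hg hV h
    simp only [real_inner_smul_left]
    rw [mvfderiv_fun_mul hg (hV.inner hW), covDerivAlong_smul cov hg hV]
    simp only [add_apply, smul_apply, h, smul_eq_mul, inner_add_left, real_inner_smul_left]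
    ring
  · intro V U hV hVU h
    rw [covDerivAlong_congr cov hVU, hVU.self_of_nhds, ← h,
      mvfderiv_congr (w := fun z ↦ inner ℝ (V z) (W z))
        (hVU.mono fun z hz ↦ by simp only [hz])]

end Metric

end AlongRules

/-! ### Symmetry of the derivative along an immersion. -/

section Torsion

variable {E : Type*} [NormedAddCommGroup E] [NormedSpace ℝ E]
  {H : Type*} [TopologicalSpace H] {I : ModelWithCorners ℝ E H}
  {M : Type*} [TopologicalSpace M] [ChartedSpace H M] [IsManifold I ∞ M]
  {E' : Type*} [NormedAddCommGroup E'] [NormedSpace ℝ E']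
  {H' : Type*} [TopologicalSpace H'] {I' : ModelWithCorners ℝ E' H'}
  {N : Type*} [TopologicalSpace N] [ChartedSpace H' N] [IsManifold I' ∞ N]
  {f : M → N} {x : M}

omit [IsManifold I ∞ M] in
lemma coordAlong_mfderiv (hf : ContMDiff I I' ∞ f) (X : ∀ x : M, TangentSpace I x) :
    coordAlong I' f (fun z ↦ mfderiv I I' f z (X z)) x =ᶠ[𝓝 x]
      fun z ↦ mvfderiv I (extChartAt I' (f x) ∘ f) z (X z) := by
  filter_upwards [eventually_mem_baseSet ((hf x).mdifferentiableAt (by simp))] with z hz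
  have hz' : f z ∈ (chartAt H' (f x)).source := by
    rwa [TangentBundle.trivializationAt_baseSet] at hz
  rw [coordAlong, ← Trivialization.continuousLinearMapAt_apply_of_mem (R := ℝ) _ hz,
    TangentBundle.continuousLinearMapAt_trivializationAt hz']
  exact (mfderiv_comp_apply z (mdifferentiableAt_extChartAt hz')
    ((hf z).mdifferentiableAt (by simp)) (X z)).symm

lemma diffAlongAt_mfderiv (hf : ContMDiff I I' ∞ f) {X : ∀ x : M, TangentSpace I x}
    (hX : MDifferentiableAt I (I.prod 𝓘(ℝ, E))
      (fun z ↦ TotalSpace.mk' E (E := TangentSpace I) z (X z)) x) :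
    DiffAlongAt I I' f (fun z ↦ mfderiv I I' f z (X z)) x := by
  have h : ContMDiff I.tangent I'.tangent ∞ (tangentMap I I' f) :=
    hf.contMDiff_tangentMap (by simp)
  exact ((h (⟨x, X x⟩ : TangentBundle I M)).mdifferentiableAt (by simp)).comp x hX

/-- The chart at `y` is used as a vector-valued test function: its derivatives along both extensions
are locally constant, so it is killed by the bracket, and its differential at `y` is the identity.
-/
lemma mlieBracket_extend [CompleteSpace E'] [I'.Boundaryless] {y : N} (v w : TangentSpace I' y) :
    mlieBracket I' (FiberBundle.extend E' v) (FiberBundle.extend E' w) y = 0 := by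
  have hu : ContMDiffAt I' 𝓘(ℝ, E') 2 (extChartAt I' y) y :=
    contMDiffAt_extChartAt
  have h := mvfderiv_mlieBracket hu (FiberBundle.mdifferentiableAt_extend I' E' v)
    (FiberBundle.mdifferentiableAt_extend I' E' w)
  have hc : ∀ a : TangentSpace I' y, (fun z ↦ mvfderiv I' (extChartAt I' y) z
      (FiberBundle.extend E' a z)) =ᶠ[𝓝 y]
      fun _ ↦ (trivializationAt E' (TangentSpace I') y ⟨y, a⟩).2 := by
    intro a
    refine EventuallyEq.trans ?_ (coordAlong_extend_eventually_const a)
    have hy := FiberBundle.mem_baseSet_trivializationAt' (F := E') (E := TangentSpace I') y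
    filter_upwards [(trivializationAt E' (TangentSpace I') y).open_baseSet.mem_nhds hy] with z hz
    have hz' : z ∈ (chartAt H' y).source := by
      rwa [TangentBundle.trivializationAt_baseSet] at hz
    rw [coordAlong, ← Trivialization.continuousLinearMapAt_apply_of_mem (R := ℝ) _ hz,
      TangentBundle.continuousLinearMapAt_trivializationAt hz']
    rfl
  rw [mvfderiv_congr (hc v), mvfderiv_congr (hc w), mvfderiv_const, mvfderiv_const] at h
  simp only [zero_apply, sub_zero] at h
  have hi : mfderiv I' 𝓘(ℝ, E') (extChartAt I' y) y = _ := mfderiv_extChartAt_self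
  change mfderiv I' 𝓘(ℝ, E') (extChartAt I' y) y _ = 0 at h
  rw [hi] at h
  exact h

/-- With u the ambient chart composed with `f`, the coordinate terms give X(Yu) - Y(Xu) = [X,Y]u.
The connection terms cancel, since the torsion vanishes and the coordinate extensions commute. -/
theorem covDerivAlong_mfderiv_sub_swap [CompleteSpace E] [FiniteDimensional ℝ E']
    [I.Boundaryless] [I'.Boundaryless]
    (cov : CovariantDerivative I' E' (fun y : N ↦ TangentSpace I' y)) (hcov : cov.torsion = 0)
    (hf : ContMDiff I I' ∞ f) {X Y : ∀ x : M, TangentSpace I x}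
    (hX : MDifferentiableAt I (I.prod 𝓘(ℝ, E))
      (fun z ↦ TotalSpace.mk' E (E := TangentSpace I) z (X z)) x)
    (hY : MDifferentiableAt I (I.prod 𝓘(ℝ, E))
      (fun z ↦ TotalSpace.mk' E (E := TangentSpace I) z (Y z)) x) :
    covDerivAlong I cov f (fun z ↦ mfderiv I I' f z (Y z)) x (X x)
      - covDerivAlong I cov f (fun z ↦ mfderiv I I' f z (X z)) x (Y x) =
        mfderiv I I' f x (mlieBracket I X Y x) := by
  have hfx : MDifferentiableAt I I' f x := (hf x).mdifferentiableAt (by simp)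
  have hu : ContMDiffAt I 𝓘(ℝ, E') 2 (extChartAt I' (f x) ∘ f) x :=
    contMDiffAt_extChartAt.comp x ((hf x).of_le ENat.LEInfty.out)
  have hy := FiberBundle.mem_baseSet_trivializationAt' (F := E') (E := TangentSpace I') (f x)
  have h1 := CovariantDerivative.torsion_eq_zero_iff cov |>.1 hcov
    (FiberBundle.mdifferentiableAt_extend I' E' (mfderiv I I' f x (X x)))
    (FiberBundle.mdifferentiableAt_extend I' E' (mfderiv I I' f x (Y x)))
  rw [mlieBracket_extend, FiberBundle.extend_apply_self, FiberBundle.extend_apply_self,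
    sub_eq_zero] at h1
  rw [covDerivAlong_apply, covDerivAlong_apply, mvfderiv_congr (coordAlong_mfderiv hf X),
    mvfderiv_congr (coordAlong_mfderiv hf Y), h1, add_sub_add_right_eq_sub, ← map_sub,
    ← mvfderiv_mlieBracket hu hX hY]
  have h2 : mvfderiv I (extChartAt I' (f x) ∘ f) x (mlieBracket I X Y x) =
      mfderiv I' 𝓘(ℝ, E') (extChartAt I' (f x)) (f x) (mfderiv I I' f x (mlieBracket I X Y x)) :=
    mfderiv_comp_apply x (mdifferentiableAt_extChartAt (mem_chart_source H' (f x))) hfx _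
  rw [h2]
  have h3 : mfderiv I' 𝓘(ℝ, E') (extChartAt I' (f x)) (f x) = _ :=
    (TangentBundle.continuousLinearMapAt_trivializationAt (mem_chart_source H' (f x))).symm
  rw [h3]
  exact Trivialization.symmL_continuousLinearMapAt _ hy _

end Torsion

/-! ### Gauss and Weingarten formulas. -/

section GaussWeingarten

variable {E : Type*} [NormedAddCommGroup E] [NormedSpace ℝ E]
  {H : Type*} [TopologicalSpace H] {I : ModelWithCorners ℝ E H}
  {M : Type*} [TopologicalSpace M] [ChartedSpace H M]
  {E' : Type*} [NormedAddCommGroup E'] [NormedSpace ℝ E']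
  {H' : Type*} [TopologicalSpace H'] {I' : ModelWithCorners ℝ E' H'}
  {N : Type*} [TopologicalSpace N] [ChartedSpace H' N] [IsManifold I' ∞ N]
  [RiemannianBundle (fun x : M ↦ TangentSpace I x)]
  [RiemannianBundle (fun y : N ↦ TangentSpace I' y)]
  {f : M → N} {ν : ∀ x : M, TangentSpace I' (f x)} {x : M}

lemma IsImmersionWithNormal.inner_normal_self (hf : IsImmersionWithNormal (I := I) (I' := I') f ν)
    (x : M) : inner ℝ (ν x) (ν x) = 1 := by
  rw [real_inner_self_eq_norm_sq, hf.unit_normal, one_pow]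

lemma IsImmersionWithNormal.diffAlongAt_normal
    (hf : IsImmersionWithNormal (I := I) (I' := I') f ν) (x : M) : DiffAlongAt I I' f ν x :=
  (hf.smooth_normal x).mdifferentiableAt (by simp)

/-- Pairing with ν isolates the normal coefficient; the isometry condition makes the differential
injective. This is how tangential and normal parts of an identity are separated below. -/
lemma IsImmersionWithNormal.decomp_injective
    (hf : IsImmersionWithNormal (I := I) (I' := I') f ν) {v w : TangentSpace I x} {s t : ℝ}
    (h : mfderiv I I' f x v + s • ν x = mfderiv I I' f x w + t • ν x) : v = w ∧ s = t := by
  have hst : s = t := by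
    have := congrArg (fun a ↦ inner ℝ a (ν x)) h
    simpa only [inner_add_left, real_inner_smul_left, hf.normal, hf.inner_normal_self, zero_add,
      mul_one] using this
  subst hst
  refine ⟨?_, rfl⟩
  have h' : mfderiv I I' f x (v - w) = 0 := by
    rw [map_sub, sub_eq_zero]; exact add_right_cancel h
  have := hf.isometric x (v - w) (v - w)
  rw [h', inner_zero_left] at this
  exact sub_eq_zero.1 (inner_self_eq_zero.1 this.symm)

variable [FiniteDimensional ℝ E] [FiniteDimensional ℝ E']

/-- Codimension one enters here: the injective map (v, t) ↦ df(v) + tν goes between spaces of equal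
dimension. -/
lemma IsImmersionWithNormal.exists_decomp
    (hf : IsImmersionWithNormal (I := I) (I' := I') f ν)
    (hdim : Module.finrank ℝ E' = Module.finrank ℝ E + 1) (w : TangentSpace I' (f x)) :
    ∃ (v : TangentSpace I x) (t : ℝ), mfderiv I I' f x v + t • ν x = w := by
  let L : TangentSpace I x × ℝ →ₗ[ℝ] TangentSpace I' (f x) :=
    (mfderiv I I' f x).toLinearMap.coprod (LinearMap.toSpanSingleton ℝ _ (ν x))
  have hL : ∀ a, L a = mfderiv I I' f x a.1 + a.2 • ν x := fun a ↦ rfl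
  have hinj : Function.Injective L := fun a b hab ↦ by
    rw [hL, hL] at hab
    obtain ⟨h1, h2⟩ := hf.decomp_injective hab
    exact Prod.ext h1 h2
  have hfr : Module.finrank ℝ (TangentSpace I x × ℝ) =
      Module.finrank ℝ (TangentSpace I' (f x)) := by
    rw [Module.finrank_prod, Module.finrank_self]
    exact hdim.symm
  obtain ⟨a, ha⟩ := (LinearMap.injective_iff_surjective_of_finrank_eq_finrank hfr).1 hinj w
  exact ⟨a.1, a.2, ha⟩

lemma IsImmersionWithNormal.ext_inner
    (hf : IsImmersionWithNormal (I := I) (I' := I') f ν)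
    (hdim : Module.finrank ℝ E' = Module.finrank ℝ E + 1) {a b : TangentSpace I' (f x)}
    (ht : ∀ v : TangentSpace I x, inner ℝ a (mfderiv I I' f x v) = inner ℝ b (mfderiv I I' f x v))
    (hn : inner ℝ a (ν x) = inner ℝ b (ν x)) : a = b := by
  refine ext_inner_right ℝ fun w ↦ ?_
  obtain ⟨v, t, rfl⟩ := hf.exists_decomp hdim w
  rw [inner_add_right, inner_add_right, inner_smul_right, inner_smul_right, ht, hn]

variable {covN : CovariantDerivative I' E' (fun y : N ↦ TangentSpace I' y)}

lemma inner_shapeOperator (v w : TangentSpace I x) :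
    inner ℝ (shapeOperator covN f ν x v) w =
      -inner ℝ (covDerivAlong I covN f ν x v) (mfderiv I I' f x w) := by
  have h : shapeOperator covN f ν x v = -(LinearMap.adjoint (mfderiv I I' f x).toLinearMap
    (covDerivAlong I covN f ν x v)) := rfl
  rw [h, inner_neg_left, LinearMap.adjoint_inner_left]
  rfl

variable [IsContMDiffRiemannianBundle I' ∞ E' (fun y : N ↦ TangentSpace I' y)]

/-- The tangential part is the adjoint in the shape operator; the normal part vanishes on
differentiating ⟨ν, ν⟩ = 1. -/
theorem covDerivAlong_normal (hf : IsImmersionWithNormal (I := I) (I' := I') f ν)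
    (hdim : Module.finrank ℝ E' = Module.finrank ℝ E + 1) (hN : IsLeviCivita covN)
    (v : TangentSpace I x) :
    covDerivAlong I covN f ν x v = -mfderiv I I' f x (shapeOperator covN f ν x v) := by
  refine hf.ext_inner hdim (fun w ↦ ?_) ?_
  · rw [inner_neg_left, hf.isometric, inner_shapeOperator, neg_neg]
  · have h := mvfderiv_inner_along covN hN.metric (hf.diffAlongAt_normal x)
      (hf.diffAlongAt_normal x) v
    simp only [hf.inner_normal_self, mvfderiv_const, zero_apply] at h
    rw [inner_neg_left, hf.normal, neg_zero]
    rw [real_inner_comm] at h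
    linarith [real_inner_comm (covDerivAlong I covN f ν x v) (ν x)]

variable [IsManifold I ∞ M]

/-- Differentiate ⟨df Y, ν⟩ = 0. -/
theorem inner_covDerivAlong_mfderiv_normal
    (hf : IsImmersionWithNormal (I := I) (I' := I') f ν) (hN : IsLeviCivita covN)
    {Y : ∀ x : M, TangentSpace I x} (hY : MDifferentiableAt I (I.prod 𝓘(ℝ, E))
      (fun z ↦ TotalSpace.mk' E (E := TangentSpace I) z (Y z)) x) (v : TangentSpace I x) :
    inner ℝ (covDerivAlong I covN f (fun z ↦ mfderiv I I' f z (Y z)) x v) (ν x) =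
      inner ℝ (shapeOperator covN f ν x v) (Y x) := by
  have h := mvfderiv_inner_along covN hN.metric (diffAlongAt_mfderiv hf.smooth hY)
      (hf.diffAlongAt_normal x) v
  simp only [hf.normal, mvfderiv_const, zero_apply] at h
  rw [inner_shapeOperator]
  linarith [real_inner_comm (covDerivAlong I covN f ν x v) (mfderiv I I' f x (Y x))]

variable [IsContMDiffRiemannianBundle I ∞ E (fun x : M ↦ TangentSpace I x)]
  {covM : CovariantDerivative I E (fun x : M ↦ TangentSpace I x)}

/-- Koszul's uniqueness argument: the discrepancy `D` is symmetric in its first two arguments, as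
both derivatives are torsion-free, and skew in its last two, as both are metric. -/
theorem inner_covDerivAlong_mfderiv_tangent [I.Boundaryless] [I'.Boundaryless]
    (hf : IsImmersionWithNormal (I := I) (I' := I') f ν) (hN : IsLeviCivita covN)
    (hM : IsLeviCivita covM) {X Y Z : ∀ x : M, TangentSpace I x}
    (hX : MDifferentiableAt I (I.prod 𝓘(ℝ, E))
      (fun z ↦ TotalSpace.mk' E (E := TangentSpace I) z (X z)) x)
    (hY : MDifferentiableAt I (I.prod 𝓘(ℝ, E))
      (fun z ↦ TotalSpace.mk' E (E := TangentSpace I) z (Y z)) x)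
    (hZ : MDifferentiableAt I (I.prod 𝓘(ℝ, E))
      (fun z ↦ TotalSpace.mk' E (E := TangentSpace I) z (Z z)) x) :
    inner ℝ (covDerivAlong I covN f (fun z ↦ mfderiv I I' f z (Y z)) x (X x))
      (mfderiv I I' f x (Z x)) = inner ℝ (covM Y x (X x)) (Z x) := by
  let D : ∀ X Y Z : ∀ x : M, TangentSpace I x, ℝ := fun X Y Z ↦
    inner ℝ (covDerivAlong I covN f (fun z ↦ mfderiv I I' f z (Y z)) x (X x))
      (mfderiv I I' f x (Z x)) - inner ℝ (covM Y x (X x)) (Z x)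
  have hsymm : ∀ {X Y Z : ∀ x : M, TangentSpace I x}
      (_ : MDifferentiableAt I (I.prod 𝓘(ℝ, E))
        (fun z ↦ TotalSpace.mk' E (E := TangentSpace I) z (X z)) x)
      (_ : MDifferentiableAt I (I.prod 𝓘(ℝ, E))
        (fun z ↦ TotalSpace.mk' E (E := TangentSpace I) z (Y z)) x), D X Y Z = D Y X Z := by
    intro X Y Z hX hY
    have h1 := covDerivAlong_mfderiv_sub_swap covN hN.torsion_free hf.smooth hX hY
    rw [← CovariantDerivative.torsion_eq_zero_iff covM |>.1 hM.torsion_free hX hY] at h1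
    have h2 := congrArg (fun a ↦ inner ℝ a (mfderiv I I' f x (Z x))) h1
    simp only [inner_sub_left, hf.isometric] at h2
    simp only [D]
    linarith
  have hskew : ∀ {X Y Z : ∀ x : M, TangentSpace I x}
      (_ : MDifferentiableAt I (I.prod 𝓘(ℝ, E))
        (fun z ↦ TotalSpace.mk' E (E := TangentSpace I) z (Y z)) x)
      (_ : MDifferentiableAt I (I.prod 𝓘(ℝ, E))
        (fun z ↦ TotalSpace.mk' E (E := TangentSpace I) z (Z z)) x), D X Y Z + D X Z Y = 0 := by
    intro X Y Z hY hZ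
    have h1 := mvfderiv_inner_along covN hN.metric (diffAlongAt_mfderiv hf.smooth hY)
      (diffAlongAt_mfderiv hf.smooth hZ) (X x)
    have h2 := hM.metric.mvfderiv_inner_eq X hY hZ
    simp only [hf.isometric] at h1
    simp only [D]
    rw [h2] at h1
    rw [real_inner_comm (Y x) (covM Z x (X x)),
      real_inner_comm (mfderiv I I' f x (Y x))]
    linarith
  -- D(X,Y,Z) = -D(X,Z,Y) = -D(Z,X,Y) = D(Z,Y,X) = D(Y,Z,X) = -D(Y,X,Z) = -D(X,Y,Z).
  have : D X Y Z = 0 := by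
    linarith [hskew (X := X) hY hZ, hskew (X := Y) hX hZ, hskew (X := Z) hX hY,
      hsymm (Z := Z) hX hY, hsymm (Z := Y) hX hZ, hsymm (Z := X) hY hZ]
  exact sub_eq_zero.1 this

theorem covDerivAlong_mfderiv [I.Boundaryless] [I'.Boundaryless]
    (hf : IsImmersionWithNormal (I := I) (I' := I') f ν)
    (hdim : Module.finrank ℝ E' = Module.finrank ℝ E + 1) (hN : IsLeviCivita covN)
    (hM : IsLeviCivita covM) {Y : ∀ x : M, TangentSpace I x}
    (hY : MDifferentiableAt I (I.prod 𝓘(ℝ, E))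
      (fun z ↦ TotalSpace.mk' E (E := TangentSpace I) z (Y z)) x) (v : TangentSpace I x) :
    covDerivAlong I covN f (fun z ↦ mfderiv I I' f z (Y z)) x v =
      mfderiv I I' f x (covM Y x v) + inner ℝ (shapeOperator covN f ν x v) (Y x) • ν x := by
  refine hf.ext_inner hdim (fun w ↦ ?_) ?_
  · have h := inner_covDerivAlong_mfderiv_tangent hf hN hM
      (FiberBundle.mdifferentiableAt_extend I E v) hY (FiberBundle.mdifferentiableAt_extend I E w)
    simp only [FiberBundle.extend_apply_self] at h
    rw [h, inner_add_left, real_inner_smul_left, hf.isometric,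
      real_inner_comm (mfderiv I I' f x w) (ν x), hf.normal, mul_zero, add_zero]
  · rw [inner_covDerivAlong_mfderiv_normal hf hN hY, inner_add_left, real_inner_smul_left,
      hf.normal, hf.inner_normal_self, zero_add, mul_one]

end GaussWeingarten

/-! ### Closure properties of smooth vector fields. -/

section SmoothFields

variable {E : Type*} [NormedAddCommGroup E] [NormedSpace ℝ E]
  {H : Type*} [TopologicalSpace H] {I : ModelWithCorners ℝ E H}
  {M : Type*} [TopologicalSpace M] [ChartedSpace H M] [IsManifold I ∞ M]
  {X Y : ∀ x : M, TangentSpace I x}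

lemma IsSmoothField.mdifferentiableAt (hX : IsSmoothField X) (x : M) :
    MDifferentiableAt I (I.prod 𝓘(ℝ, E))
      (fun z ↦ TotalSpace.mk' E (E := TangentSpace I) z (X z)) x :=
  ContMDiffAt.mdifferentiableAt (hX x) (by simp)

lemma IsSmoothField.clm_apply {T : ∀ x : M, TangentSpace I x →L[ℝ] TangentSpace I x}
    (hT : IsSmoothEndField T) (hX : IsSmoothField X) : IsSmoothField (fun x ↦ T x (X x)) :=
  ContMDiff.clm_bundle_apply hT hX

lemma IsSmoothField.neg (hX : IsSmoothField X) : IsSmoothField (fun x ↦ -X x) :=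
  ContMDiff.neg_section hX

lemma IsSmoothField.sub (hX : IsSmoothField X) (hY : IsSmoothField Y) :
    IsSmoothField (fun x ↦ X x - Y x) :=
  ContMDiff.sub_section hX hY

lemma IsSmoothField.cov {cov : CovariantDerivative I E (fun x : M ↦ TangentSpace I x)}
    (hcov : CovariantDerivative.ContMDiffCovariantDerivative cov ∞) (hX : IsSmoothField X)
    (hY : IsSmoothField Y) : IsSmoothField (fun x ↦ cov Y x (X x)) := by
  have h := hcov.contMDiff.contMDiff (σ := Y) (contMDiffOn_univ.2 hY)
  exact ContMDiff.clm_bundle_apply (contMDiffOn_univ.1 h) hX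

end SmoothFields

/-! ### The structure equations and the curvature in direction ξ. -/

section PhiHypersurface

variable {E : Type*} [NormedAddCommGroup E] [NormedSpace ℝ E]
  {H : Type*} [TopologicalSpace H] {I : ModelWithCorners ℝ E H}
  {M : Type*} [TopologicalSpace M] [ChartedSpace H M] [IsManifold I ∞ M]
  {E' : Type*} [NormedAddCommGroup E'] [NormedSpace ℝ E']
  {H' : Type*} [TopologicalSpace H'] {I' : ModelWithCorners ℝ E' H'}
  {N : Type*} [TopologicalSpace N] [ChartedSpace H' N] [IsManifold I' ∞ N]
  [RiemannianBundle (fun x : M ↦ TangentSpace I x)]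
  [RiemannianBundle (fun y : N ↦ TangentSpace I' y)]
  {f : M → N} {ν : ∀ x : M, TangentSpace I' (f x)} {x : M}
  {covM : CovariantDerivative I E (fun x : M ↦ TangentSpace I x)}
  {covN : CovariantDerivative I' E' (fun y : N ↦ TangentSpace I' y)}
  {p q : ℕ} {J : ∀ y : N, TangentSpace I' y →L[ℝ] TangentSpace I' y}
  {φ : ∀ x : M, TangentSpace I x →L[ℝ] TangentSpace I x}
  {η : ∀ x : M, TangentSpace I x →L[ℝ] ℝ} {ξ : ∀ x : M, TangentSpace I x}

/-- Symmetry of `J` on the pair df(ξ), ν compares ⟨ν, ν⟩ = 1 with q g(ξ, ξ) = q. A point of `M` is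
needed because `M` may be empty. -/
lemma IsQuadraticMetricPhiHypersurface.cast_q_eq_one (hJ : IsLocallyMetallic covN p q J)
    (hφ : IsQuadraticMetricPhiHypersurface p q J f ν φ η ξ) (x : M) : (q : ℝ) = 1 := by
  have hf := hφ.hypersurface
  have h := hJ.symm (f x) (mfderiv I I' f x (ξ x)) (ν x)
  rw [hφ.J_xi, hφ.J_normal, inner_add_right, inner_smul_right, inner_smul_right, hf.normal,
    hf.isometric, hf.inner_normal_self, real_inner_self_eq_norm_sq, hφ.quadratic.unit_xi] at h
  linarith

lemma IsQuadraticMetricPhiHypersurface.eta_apply (hJ : IsLocallyMetallic covN p q J)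
    (hφ : IsQuadraticMetricPhiHypersurface p q J f ν φ η ξ) (v : TangentSpace I x) :
    η x v = inner ℝ v (ξ x) := by
  have hf := hφ.hypersurface
  have h := hJ.symm (f x) (mfderiv I I' f x v) (ν x)
  rw [hφ.J_tangent, hφ.J_normal, inner_add_right, inner_smul_right, inner_smul_right, hf.normal,
    hf.isometric, inner_add_left, real_inner_smul_left, hf.normal, hf.inner_normal_self,
    hφ.cast_q_eq_one hJ x] at h
  linarith

variable [FiniteDimensional ℝ E] [FiniteDimensional ℝ E'] [I.Boundaryless] [I'.Boundaryless]
  [IsContMDiffRiemannianBundle I ∞ E (fun x : M ↦ TangentSpace I x)]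
  [IsContMDiffRiemannianBundle I' ∞ E' (fun y : N ↦ TangentSpace I' y)]

/-- The two claims are the tangential and normal parts of the derivative of Jν = qξ + pν. The normal
part reads g(Av, ξ) = -η(Av), whereas η = g(·, ξ), so both vanish. -/
lemma IsQuadraticMetricPhiHypersurface.cov_xi_aux
    (hdim : Module.finrank ℝ E' = Module.finrank ℝ E + 1)
    (hN : IsLeviCivita covN) (hM : IsLeviCivita covM) (hJ : IsLocallyMetallic covN p q J)
    (hφ : IsQuadraticMetricPhiHypersurface p q J f ν φ η ξ) (v : TangentSpace I x) :
    covM ξ x v = (p : ℝ) • shapeOperator covN f ν x v - φ x (shapeOperator covN f ν x v) ∧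
      η x (shapeOperator covN f ν x v) = 0 := by
  have hf := hφ.hypersurface
  have hξ := hφ.quadratic.smooth_xi.mdifferentiableAt x
  have hν := hf.diffAlongAt_normal x
  have hdξ := diffAlongAt_mfderiv hf.smooth hξ
  set A := shapeOperator covN f ν x v with hA
  have h1 := covDerivAlong_clm_apply covN hJ.smooth hJ.parallel hν v
  have hq : MDifferentiableAt I 𝓘(ℝ, ℝ) (fun _ : M ↦ (q : ℝ)) x := mdifferentiableAt_const
  have hp : MDifferentiableAt I 𝓘(ℝ, ℝ) (fun _ : M ↦ (p : ℝ)) x := mdifferentiableAt_const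
  simp only [hφ.J_normal] at h1
  rw [covDerivAlong_add covN (hdξ.smul hq) (hν.smul hp), covDerivAlong_smul covN hq hdξ,
    covDerivAlong_smul covN hp hν, covDerivAlong_mfderiv hf hdim hN hM hξ,
    covDerivAlong_normal hf hdim hN, map_neg, hφ.J_tangent, ← hA, hφ.cast_q_eq_one hJ x,
    mvfderiv_const, mvfderiv_const] at h1
  have h2 : mfderiv I I' f x (covM ξ x v) + (inner ℝ A (ξ x)) • ν x =
      mfderiv I I' f x ((p : ℝ) • A - φ x A) + (-η x A) • ν x := by
    rw [map_sub, map_smul]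
    simp only [zero_apply, zero_smul, one_smul, add_zero, smul_neg] at h1
    rw [← sub_eq_zero] at h1 ⊢
    rw [← h1]
    module
  obtain ⟨h3, h4⟩ := hf.decomp_injective h2
  rw [← hφ.eta_apply hJ] at h4
  exact ⟨h3, by linarith⟩

/-- `∇_v ξ = pAv - φAv`. -/
theorem IsQuadraticMetricPhiHypersurface.cov_xi
    (hdim : Module.finrank ℝ E' = Module.finrank ℝ E + 1)
    (hN : IsLeviCivita covN) (hM : IsLeviCivita covM) (hJ : IsLocallyMetallic covN p q J)
    (hφ : IsQuadraticMetricPhiHypersurface p q J f ν φ η ξ) (v : TangentSpace I x) :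
    covM ξ x v = (p : ℝ) • shapeOperator covN f ν x v - φ x (shapeOperator covN f ν x v) :=
  (hφ.cov_xi_aux hdim hN hM hJ v).1

theorem IsQuadraticMetricPhiHypersurface.eta_shapeOperator
    (hdim : Module.finrank ℝ E' = Module.finrank ℝ E + 1)
    (hN : IsLeviCivita covN) (hM : IsLeviCivita covM) (hJ : IsLocallyMetallic covN p q J)
    (hφ : IsQuadraticMetricPhiHypersurface p q J f ν φ η ξ) (v : TangentSpace I x) :
    η x (shapeOperator covN f ν x v) = 0 :=
  (hφ.cov_xi_aux hdim hN hM hJ v).2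

/-- `Av = -φ(∇_v ξ)`. -/
lemma IsQuadraticMetricPhiHypersurface.shapeOperator_eq
    (hdim : Module.finrank ℝ E' = Module.finrank ℝ E + 1)
    (hN : IsLeviCivita covN) (hM : IsLeviCivita covM) (hJ : IsLocallyMetallic covN p q J)
    (hφ : IsQuadraticMetricPhiHypersurface p q J f ν φ η ξ) (v : TangentSpace I x) :
    shapeOperator covN f ν x v = -φ x (covM ξ x v) := by
  rw [hφ.cov_xi hdim hN hM hJ, map_sub, map_smul, hφ.quadratic.phi_sq,
    hφ.eta_shapeOperator hdim hN hM hJ, hφ.cast_q_eq_one hJ x]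
  module

/-- Smoothness is read off from A = -φ(∇ξ), which avoids the pointwise adjoint in the definition of
the shape operator. -/
lemma IsQuadraticMetricPhiHypersurface.isSmoothField_shapeOperator
    (hdim : Module.finrank ℝ E' = Module.finrank ℝ E + 1)
    (hN : IsLeviCivita covN) (hM : IsLeviCivita covM) (hJ : IsLocallyMetallic covN p q J)
    (hφ : IsQuadraticMetricPhiHypersurface p q J f ν φ η ξ) {Y : ∀ x : M, TangentSpace I x}
    (hY : IsSmoothField Y) : IsSmoothField (fun x ↦ shapeOperator covN f ν x (Y x)) := by
  simp only [hφ.shapeOperator_eq hdim hN hM hJ]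
  exact ((hY.cov hM.smooth hφ.quadratic.smooth_xi).clm_apply hφ.quadratic.smooth_phi).neg

/-- `(∇_X φ) Y = g(AX, Y) ξ + η(Y) AX`. -/
theorem IsQuadraticMetricPhiHypersurface.covDerivEnd_phi
    (hdim : Module.finrank ℝ E' = Module.finrank ℝ E + 1)
    (hN : IsLeviCivita covN) (hM : IsLeviCivita covM) (hJ : IsLocallyMetallic covN p q J)
    (hφ : IsQuadraticMetricPhiHypersurface p q J f ν φ η ξ) (X : ∀ x : M, TangentSpace I x)
    {Y : ∀ x : M, TangentSpace I x} (hY : IsSmoothField Y) (x : M) :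
    covDerivEnd covM φ X Y x = inner ℝ (shapeOperator covN f ν x (X x)) (Y x) • ξ x
      + η x (Y x) • shapeOperator covN f ν x (X x) := by
  have hf := hφ.hypersurface
  have hν := hf.diffAlongAt_normal x
  have hY' := hY.mdifferentiableAt x
  have hφY := (hY.clm_apply hφ.quadratic.smooth_phi).mdifferentiableAt x
  have hη : MDifferentiableAt I 𝓘(ℝ, ℝ) (fun z ↦ η z (Y z)) x := by
    simp only [hφ.eta_apply hJ]
    exact MDifferentiableAt.inner_bundle (E := fun x : M ↦ TangentSpace I x) hY'
      (hφ.quadratic.smooth_xi.mdifferentiableAt x)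
  have h1 := covDerivAlong_clm_apply covN hJ.smooth hJ.parallel
    (diffAlongAt_mfderiv hf.smooth hY') (X x)
  simp only [hφ.J_tangent] at h1
  rw [covDerivAlong_add covN (diffAlongAt_mfderiv hf.smooth hφY) (hν.smul hη),
    covDerivAlong_smul covN hη hν, covDerivAlong_mfderiv hf hdim hN hM hφY,
    covDerivAlong_normal hf hdim hN, covDerivAlong_mfderiv hf hdim hN hM hY', map_add, map_smul,
    hφ.J_tangent, hφ.J_normal, hφ.cast_q_eq_one hJ x] at h1
  set A := shapeOperator covN f ν x (X x)
  set k := mvfderiv I (fun z ↦ η z (Y z)) x (X x)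
  -- The derivative of JY = φY + η(Y)ν, sorted into tangential and normal parts; only the tangential
  -- one is used.
  have h2 : mfderiv I I' f x (covM (fun z ↦ φ z (Y z)) x (X x) - η x (Y x) • A)
        + (inner ℝ A (φ x (Y x)) + k) • ν x =
      mfderiv I I' f x (φ x (covM Y x (X x)) + inner ℝ A (Y x) • ξ x)
        + (η x (covM Y x (X x)) + inner ℝ A (Y x) * (p : ℝ)) • ν x := by
    rw [map_sub, map_add, map_smul, map_smul]
    rw [← sub_eq_zero] at h1 ⊢
    rw [← h1]
    module
  have h3 := (hf.decomp_injective h2).1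
  rw [covDerivEnd, ← sub_eq_zero]
  rw [← sub_eq_zero] at h3
  rw [← h3]
  module

/-- `R(X,Y)ξ = p((∇_X A)Y - (∇_Y A)X) - φ((∇_X A)Y - (∇_Y A)X)`. -/
theorem IsQuadraticMetricPhiHypersurface.curvature_xi
    (hdim : Module.finrank ℝ E' = Module.finrank ℝ E + 1)
    (hN : IsLeviCivita covN) (hM : IsLeviCivita covM) (hJ : IsLocallyMetallic covN p q J)
    (hφ : IsQuadraticMetricPhiHypersurface p q J f ν φ η ξ) {X Y : ∀ x : M, TangentSpace I x}
    (hX : IsSmoothField X) (hY : IsSmoothField Y) (x : M) :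
    curvature covM X Y ξ x =
      (p : ℝ) • (covDerivEnd covM (shapeOperator covN f ν) X Y x
        - covDerivEnd covM (shapeOperator covN f ν) Y X x)
      - φ x (covDerivEnd covM (shapeOperator covN f ν) X Y x
        - covDerivEnd covM (shapeOperator covN f ν) Y X x) := by
  have key : ∀ {X Y : ∀ x : M, TangentSpace I x}, IsSmoothField Y →
      covM (fun z ↦ covM ξ z (Y z)) x (X x) =
        (p : ℝ) • covM (fun z ↦ shapeOperator covN f ν z (Y z)) x (X x)
        - (φ x (covM (fun z ↦ shapeOperator covN f ν z (Y z)) x (X x))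
          + inner ℝ (shapeOperator covN f ν x (X x)) (shapeOperator covN f ν x (Y x)) • ξ x) := by
    intro X Y hY
    have hA := hφ.isSmoothField_shapeOperator hdim hN hM hJ hY
    have hφA := (hA.clm_apply hφ.quadratic.smooth_phi).mdifferentiableAt x
    have h1 := hφ.covDerivEnd_phi hdim hN hM hJ X hA x
    -- For the field AY, the η-term of (∇_X φ)(AY) vanishes because η ∘ A = 0.
    rw [hφ.eta_shapeOperator hdim hN hM hJ, zero_smul, add_zero, covDerivEnd, sub_eq_iff_eq_add']
      at h1
    have h2 : (fun z ↦ covM ξ z (Y z)) =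
        (p : ℝ) • (fun z ↦ shapeOperator covN f ν z (Y z))
          + (-1 : ℝ) • (fun z ↦ φ z (shapeOperator covN f ν z (Y z))) := by
      funext z
      simp only [hφ.cov_xi hdim hN hM hJ, Pi.add_apply, Pi.smul_apply]
      module
    have hs : ∀ (c : ℝ) {Z : ∀ x : M, TangentSpace I x}, MDifferentiableAt I (I.prod 𝓘(ℝ, E))
        (fun z ↦ TotalSpace.mk' E (E := TangentSpace I) z (Z z)) x →
        MDifferentiableAt I (I.prod 𝓘(ℝ, E))
          (fun z ↦ TotalSpace.mk' E (E := TangentSpace I) z ((c • Z) z)) x := fun c Z hZ ↦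
      MDifferentiableAt.smul_section (f := fun _ ↦ c) mdifferentiableAt_const hZ
    rw [h2, covM.isCovariantDerivativeOn.add (hs _ (hA.mdifferentiableAt x)) (hs _ hφA),
      covM.isCovariantDerivativeOn.smul_const _ (hA.mdifferentiableAt x),
      covM.isCovariantDerivativeOn.smul_const _ hφA]
    simp only [add_apply, smul_apply, h1]
    module
  have hb := CovariantDerivative.torsion_eq_zero_iff covM |>.1 hM.torsion_free
    (hX.mdifferentiableAt x) (hY.mdifferentiableAt x)
  -- Commuting the inner product makes the two g(AX, AY)ξ terms identical, so they cancel.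
  rw [curvature, key hY, key hX, hφ.cov_xi hdim hN hM hJ, ← hb, covDerivEnd, covDerivEnd,
    real_inner_comm (shapeOperator covN f ν x (X x))]
  simp only [map_sub]
  module

/-- Since h(Y, Z) = g(AY, Z), metric compatibility turns parallelism of h into g((∇_X A)Y, Z) = 0.
Parallelism is assumed for smooth fields only, so (∇_X A)Y is first shown smooth and then itself
taken as Z. -/
theorem IsQuadraticMetricPhiHypersurface.covDerivEnd_shapeOperator_eq_zero
    (hdim : Module.finrank ℝ E' = Module.finrank ℝ E + 1)
    (hN : IsLeviCivita covN) (hM : IsLeviCivita covM) (hJ : IsLocallyMetallic covN p q J)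
    (hφ : IsQuadraticMetricPhiHypersurface p q J f ν φ η ξ)
    (hpar : IsParallelSecondFundamentalForm covN covM f ν) {X Y : ∀ x : M, TangentSpace I x}
    (hX : IsSmoothField X) (hY : IsSmoothField Y) (x : M) :
    covDerivEnd covM (shapeOperator covN f ν) X Y x = 0 := by
  have hf := hφ.hypersurface
  have hA := hφ.isSmoothField_shapeOperator hdim hN hM hJ hY
  set Z : ∀ x : M, TangentSpace I x := covDerivEnd covM (shapeOperator covN f ν) X Y with hZdef
  have hZ : IsSmoothField Z := (hX.cov hM.smooth hA).sub
    (hφ.isSmoothField_shapeOperator hdim hN hM hJ (hX.cov hM.smooth hY))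
  have hII : ∀ Y Z : ∀ x : M, TangentSpace I x, IsSmoothField Z →
      secondFundamentalForm covN f ν Y Z =
        fun z ↦ inner ℝ (shapeOperator covN f ν z (Y z)) (Z z) := fun Y Z hZ ↦ by
    funext z
    exact inner_covDerivAlong_mfderiv_normal hf hN (hZ.mdifferentiableAt z) (Y z)
  have h1 := hpar X Y Z hX hY hZ x
  rw [hII _ _ hZ, hII _ _ hZ, hII _ _ (hX.cov hM.smooth hZ)] at h1
  have h2 := hM.metric.mvfderiv_inner_eq X (hA.mdifferentiableAt x) (hZ.mdifferentiableAt x)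
  have h3 : inner ℝ (Z x) (Z x) = 0 := by
    have h4 := h2.symm.trans h1
    have h5 : Z x = covM (fun z ↦ shapeOperator covN f ν z (Y z)) x (X x)
      - shapeOperator covN f ν x (covM Y x (X x)) := rfl
    nth_rewrite 1 [h5]
    rw [inner_sub_left]
    linarith
  exact inner_self_eq_zero.1 h3

end PhiHypersurface

end MetallicHypersurface
end

theorem mainTheorem10 {n : ℕ}
    {N : Type*} [TopologicalSpace N] [T2Space N] [ChartedSpace (EuclideanSpace ℝ (Fin (n + 1))) N]
    [IsManifold (𝓡 (n + 1)) ∞ N]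
    [RiemannianBundle (fun y : N ↦ TangentSpace (𝓡 (n + 1)) y)]
    [IsContMDiffRiemannianBundle (𝓡 (n + 1)) ∞ (EuclideanSpace ℝ (Fin (n + 1)))
      (fun y : N ↦ TangentSpace (𝓡 (n + 1)) y)]
    {M : Type*} [TopologicalSpace M] [T2Space M] [ChartedSpace (EuclideanSpace ℝ (Fin n)) M]
    [IsManifold (𝓡 n) ∞ M]
    [RiemannianBundle (fun x : M ↦ TangentSpace (𝓡 n) x)]
    [IsContMDiffRiemannianBundle (𝓡 n) ∞ (EuclideanSpace ℝ (Fin n))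
      (fun x : M ↦ TangentSpace (𝓡 n) x)]
    (p q : ℕ)
    (covN : CovariantDerivative (𝓡 (n + 1)) (EuclideanSpace ℝ (Fin (n + 1)))
      (fun y : N ↦ TangentSpace (𝓡 (n + 1)) y))
    (hcovN : MetallicHypersurface.IsLeviCivita covN)
    (J : ∀ y : N, TangentSpace (𝓡 (n + 1)) y →L[ℝ] TangentSpace (𝓡 (n + 1)) y)
    (hJ : MetallicHypersurface.IsLocallyMetallic covN p q J)
    (covM : CovariantDerivative (𝓡 n) (EuclideanSpace ℝ (Fin n))
      (fun x : M ↦ TangentSpace (𝓡 n) x))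
    (hcovM : MetallicHypersurface.IsLeviCivita covM)
    (f : M → N) (ν : ∀ x : M, TangentSpace (𝓡 (n + 1)) (f x))
    (φ : ∀ x : M, TangentSpace (𝓡 n) x →L[ℝ] TangentSpace (𝓡 n) x)
    (η : ∀ x : M, TangentSpace (𝓡 n) x →L[ℝ] ℝ)
    (ξ : ∀ x : M, TangentSpace (𝓡 n) x)
    (hM : MetallicHypersurface.IsQuadraticMetricPhiHypersurface p q J f ν φ η ξ) :
    let A := MetallicHypersurface.shapeOperator (I := 𝓡 n) covN f ν
    (∀ X Y : ∀ x : M, TangentSpace (𝓡 n) x,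
      MetallicHypersurface.IsSmoothField X → MetallicHypersurface.IsSmoothField Y → ∀ x : M,
        MetallicHypersurface.curvature covM X Y ξ x =
          (p : ℝ) • (MetallicHypersurface.covDerivEnd covM A X Y x
              - MetallicHypersurface.covDerivEnd covM A Y X x)
            - φ x (MetallicHypersurface.covDerivEnd covM A X Y x
              - MetallicHypersurface.covDerivEnd covM A Y X x)) ∧
    (MetallicHypersurface.IsParallelSecondFundamentalForm covN covM f ν →
      ∀ X Y : ∀ x : M, TangentSpace (𝓡 n) x,
        MetallicHypersurface.IsSmoothField X → MetallicHypersurface.IsSmoothField Y → ∀ x : M,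
          MetallicHypersurface.curvature covM X Y ξ x = 0) := by
  have hdim : Module.finrank ℝ (EuclideanSpace ℝ (Fin (n + 1))) =
      Module.finrank ℝ (EuclideanSpace ℝ (Fin n)) + 1 := by
    simp
  have hR := fun X Y hX hY x ↦
    hM.curvature_xi hdim hcovN hcovM hJ (X := X) (Y := Y) hX hY x
  refine ⟨hR, fun hpar X Y hX hY x ↦ ?_⟩
  rw [hR X Y hX hY x, hM.covDerivEnd_shapeOperator_eq_zero hdim hcovN hcovM hJ hpar hX hY,
    hM.covDerivEnd_shapeOperator_eq_zero hdim hcovN hcovM hJ hpar hY hX, sub_zero, smul_zero,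
    map_zero, sub_zero]
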